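/- Let $(M,\Pi)$ be a Poisson manifold of dimension $n$ (manifolds are smooth and Hausdorff), with bracket $\{f,g\}=\Pi(\mathrm df,\mathrm dg)$ and Hamiltonian vector fields $X_f=\{\cdot,f\}$. Let $\mathcal F$ be a (regular) foliation of $M$ with leaves of dimension $r$ and of codimension $q=n-r$. A first integral of $\mathcal F$ on an open set $U\subset M$ is a smooth function on $U$ which is constant on the leaves of $\mathcal F|_U$. Suppose that $(M,\Pi,\mathcal F)$ is an abstract non-commutative integrable (NCI) system of rank $r$: every $m\in M$ has an open neighborhood $U$ on which there are first integrals $f_1,\dots,f_r$ of $\mathcal F$ whose Hamiltonian vector fields span $T_{x}\mathcal F$ for every $x\in U$. Suppose also that the leaf space of $\mathcal F$ is a manifold $B$ of dimension $q$ with quotient map (momentum map) $\phi:M\to B$, i.e. $\phi$ is a surjective smooth submersion whose fibers are exactly the leaves of $\mathcal F$. Then: 1. There exists a unique Poisson structure $\pi$ on $B$ such that $\phi:(M,\Pi)\to(B,\pi)$ is a Poisson map. 2. Let $f$ be a smooth function on an open set $U\subset M$ whose Hamiltonian vector field $X_f$ is tangent to the leaves of $\mathcal F$ at every point of $U$. Then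 $f$ descends locally to $B$: every $m\in U$ has an open neighborhood $U'\subset U$ on which $f=g\circ\phi$ for some function $g$; and if $U$ is saturated (a union of leaves) one can take $U'=U$. Moreover, whenever $U'\subset U$ is open and $f=g\circ\phi$ on $U'$, the set $\phi(U')$ is open in $B$ and $g$ is a (smooth) Casimir function of $\pi$ on $\phi(U')$, i.e. $\{g,h\}_\pi=0$ on $W$ for every smooth function $h$ on an open set $W\subset\phi(U')$. 3. For every $m\in M$, $\operatorname{rank}\pi_{\phi(m)}=\operatorname{rank}\Pi_m-2r$. -/

import Mathlib

open Set
open scoped Manifold ContDiff Topology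

noncomputable section

namespace NCI

/-! ### Poisson manifolds -/

section Poisson

variable {n : ℕ} {M : Type*} [TopologicalSpace M] [ChartedSpace (EuclideanSpace ℝ (Fin n)) M]

/-- The bracket `{f, g} = Π(df, dg) = ⟨dg, Π♯(df)⟩` of two functions, with respect to a field
`Π♯` of linear maps from cotangent spaces to tangent spaces. -/
def bracketOf (sharp : ∀ m : M, (TangentSpace (𝓡 n) m →L[ℝ] ℝ) →ₗ[ℝ] TangentSpace (𝓡 n) m)
    (f g : M → ℝ) (m : M) : ℝ :=
  mvfderiv (𝓡 n) g m (sharp m (mvfderiv (𝓡 n) f m))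

end Poisson

/-- A Poisson structure on an `n`-dimensional manifold: a smooth bivector field `Π`, given by its
skew-symmetric maps `Π♯ₘ : T*ₘM → TₘM`, `⟨β, Π♯ₘ α⟩ = Πₘ(α, β)`, whose bracket of (locally defined)
smooth functions satisfies the Jacobi identity. Smoothness of `Π` is expressed by the smoothness of
the brackets of all locally defined smooth functions (in particular of all local coordinates). -/
@[ext]
structure PoissonStructure (n : ℕ) (M : Type*) [TopologicalSpace M]
    [ChartedSpace (EuclideanSpace ℝ (Fin n)) M] where
  /-- The map `Π♯ₘ : T*ₘM → TₘM`. -/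
  sharp : ∀ m : M, (TangentSpace (𝓡 n) m →L[ℝ] ℝ) →ₗ[ℝ] TangentSpace (𝓡 n) m
  skew : ∀ (m : M) (α β : TangentSpace (𝓡 n) m →L[ℝ] ℝ), β (sharp m α) = - α (sharp m β)
  smooth : ∀ (U : Set M) (f g : M → ℝ), IsOpen U →
    ContMDiffOn (𝓡 n) 𝓘(ℝ, ℝ) ∞ f U → ContMDiffOn (𝓡 n) 𝓘(ℝ, ℝ) ∞ g U →
    ContMDiffOn (𝓡 n) 𝓘(ℝ, ℝ) ∞ (bracketOf sharp f g) U
  jacobi : ∀ (U : Set M) (f g h : M → ℝ), IsOpen U →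
    ContMDiffOn (𝓡 n) 𝓘(ℝ, ℝ) ∞ f U → ContMDiffOn (𝓡 n) 𝓘(ℝ, ℝ) ∞ g U →
    ContMDiffOn (𝓡 n) 𝓘(ℝ, ℝ) ∞ h U → ∀ m ∈ U,
    bracketOf sharp f (bracketOf sharp g h) m + bracketOf sharp g (bracketOf sharp h f) m +
      bracketOf sharp h (bracketOf sharp f g) m = 0

namespace PoissonStructure

variable {n : ℕ} {M : Type*} [TopologicalSpace M] [ChartedSpace (EuclideanSpace ℝ (Fin n)) M]

/-- The Poisson bracket `{f, g}`. -/
def bracket (P : PoissonStructure n M) (f g : M → ℝ) : M → ℝ := bracketOf P.sharp f g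

/-- The Hamiltonian vector field `X_f = {·, f}`, i.e. `⟨dh, X_f⟩ = {h, f}`. -/
def hamVF (P : PoissonStructure n M) (f : M → ℝ) (m : M) : TangentSpace (𝓡 n) m :=
  - P.sharp m (mvfderiv (𝓡 n) f m)

theorem mvfderiv_hamVF (P : PoissonStructure n M) (f h : M → ℝ) (m : M) :
    mvfderiv (𝓡 n) h m (P.hamVF f m) = P.bracket h f m := by
  have := P.skew m (mvfderiv (𝓡 n) f m) (mvfderiv (𝓡 n) h m)
  simp [hamVF, bracket, bracketOf, this]

/-- The rank of the bivector `Πₘ`. -/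
def rank (P : PoissonStructure n M) (m : M) : ℕ :=
  Module.finrank ℝ (LinearMap.range (P.sharp m))

/-- `g` is a Casimir function on the set `V` (meant to be open): it is smooth on `V` and
`{g, h} = 0` for every smooth function `h` defined on an open subset of `V`. -/
def IsCasimirOn (P : PoissonStructure n M) (g : M → ℝ) (V : Set M) : Prop :=
  ContMDiffOn (𝓡 n) 𝓘(ℝ, ℝ) ∞ g V ∧
    ∀ (W : Set M) (h : M → ℝ), IsOpen W → W ⊆ V → ContMDiffOn (𝓡 n) 𝓘(ℝ, ℝ) ∞ h W →
      ∀ x ∈ W, P.bracket g h x = 0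

end PoissonStructure

/-- `φ : (M, Π) → (B, π)` is a Poisson map: it is smooth and
`{g ∘ φ, h ∘ φ}_Π = {g, h}_π ∘ φ` for all (locally defined) smooth functions `g`, `h` on `B`. -/
def IsPoissonMap {n q : ℕ} {M B : Type*}
    [TopologicalSpace M] [ChartedSpace (EuclideanSpace ℝ (Fin n)) M]
    [TopologicalSpace B] [ChartedSpace (EuclideanSpace ℝ (Fin q)) B]
    (P : PoissonStructure n M) (Q : PoissonStructure q B) (φ : M → B) : Prop :=
  ContMDiff (𝓡 n) (𝓡 q) ∞ φ ∧
    ∀ (V : Set B) (g h : B → ℝ), IsOpen V →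
      ContMDiffOn (𝓡 q) 𝓘(ℝ, ℝ) ∞ g V → ContMDiffOn (𝓡 q) 𝓘(ℝ, ℝ) ∞ h V →
      ∀ m ∈ φ ⁻¹' V, P.bracket (g ∘ φ) (h ∘ φ) m = Q.bracket g h (φ m)

/-! ### Foliations -/

/-- A (smooth, regular) foliation with leaves of dimension `r` and codimension `q` of an
`n`-dimensional manifold, given by a foliated atlas: smooth charts `e = (ψ, φ)` onto `ℝʳ × ℝ^q`
covering the manifold, such that the second (transverse) component of a change of charts locally
depends only on the second component. (If `M` is non-empty, then necessarily `n = r + q`.) -/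
structure Foliation (n r q : ℕ) (M : Type*) [TopologicalSpace M]
    [ChartedSpace (EuclideanSpace ℝ (Fin n)) M] where
  /-- The foliated charts. -/
  charts : Set (OpenPartialHomeomorph M (EuclideanSpace ℝ (Fin r) × EuclideanSpace ℝ (Fin q)))
  target_eq : ∀ e ∈ charts, e.target = univ
  smooth : ∀ e ∈ charts,
    ContMDiffOn (𝓡 n) 𝓘(ℝ, EuclideanSpace ℝ (Fin r) × EuclideanSpace ℝ (Fin q)) ∞ e e.source
  smooth_symm : ∀ e ∈ charts,
    ContMDiff 𝓘(ℝ, EuclideanSpace ℝ (Fin r) × EuclideanSpace ℝ (Fin q)) (𝓡 n) ∞ e.symm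
  cover : ∀ m : M, ∃ e ∈ charts, m ∈ e.source
  compat : ∀ e ∈ charts, ∀ e' ∈ charts, ∀ m ∈ e.source ∩ e'.source,
    ∃ W ∈ 𝓝 m, ∀ x ∈ W, ∀ y ∈ W, (e x).2 = (e y).2 → (e' x).2 = (e' y).2

namespace Foliation

variable {n r q : ℕ} {M : Type*} [TopologicalSpace M] [ChartedSpace (EuclideanSpace ℝ (Fin n)) M]

/-- Two points lie on a common plaque `e⁻¹(ℝʳ × {y})` of a foliated chart `e`. -/
def SamePlaque (F : Foliation n r q M) (x y : M) : Prop :=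
  ∃ e ∈ F.charts, x ∈ e.source ∧ y ∈ e.source ∧ (e x).2 = (e y).2

/-- Two points lie on the same leaf: they are joined by a finite chain of plaques. -/
def SameLeaf (F : Foliation n r q M) : M → M → Prop := Relation.EqvGen F.SamePlaque

/-- The tangent space to the foliation at `m`: the kernel of the differential of the transverse
component of a foliated chart around `m` (the kernels for the various charts coincide). -/
def tangent (F : Foliation n r q M) (m : M) : Submodule ℝ (TangentSpace (𝓡 n) m) :=
  ⨅ e ∈ F.charts, ⨅ _ : m ∈ e.source,
    LinearMap.ker (mvfderiv (𝓡 n) (fun x => (e x).2) m).toLinearMap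

/-- `f` is a (local) first integral on the set `U` (meant to be open): it is smooth on `U` and
constant on the leaves of the restriction of the foliation to `U`, that is, locally constant along
the plaques. -/
def IsFirstIntegralOn (F : Foliation n r q M) (f : M → ℝ) (U : Set M) : Prop :=
  ContMDiffOn (𝓡 n) 𝓘(ℝ, ℝ) ∞ f U ∧
    ∀ e ∈ F.charts, ∀ m ∈ U ∩ e.source,
      ∃ W ∈ 𝓝 m, ∀ x ∈ W, ∀ y ∈ W, (e x).2 = (e y).2 → f x = f y

/-- `(M, Π, F)` is an abstract non-commutative integrable system of rank `r`: near every point there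
are local first integrals `f₁, …, f_r` of the `r`-dimensional foliation `F` whose Hamiltonian
vector fields span the tangent bundle of `F`. -/
def IsAbstractNCI (F : Foliation n r q M) (P : PoissonStructure n M) : Prop :=
  ∀ m : M, ∃ U : Set M, IsOpen U ∧ m ∈ U ∧ ∃ f : Fin r → M → ℝ,
    (∀ i, F.IsFirstIntegralOn (f i) U) ∧
    ∀ x ∈ U, Submodule.span ℝ (range fun i => P.hamVF (f i) x) = F.tangent x

/-- `φ : M → B` exhibits the manifold `B` as the leaf space of `F`: it is a surjective smooth
submersion whose fibers are exactly the leaves of `F`. -/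
structure IsMomentumMap {B : Type*} [TopologicalSpace B] [ChartedSpace (EuclideanSpace ℝ (Fin q)) B]
    (F : Foliation n r q M) (φ : M → B) : Prop where
  surjective : Function.Surjective φ
  isSubmersion : Manifold.IsSubmersion (𝓡 n) (𝓡 q) ∞ φ
  fibers : ∀ x y : M, φ x = φ y ↔ F.SameLeaf x y

end Foliation

end NCI

end

/-! Everything is infinitesimal along the leaves: the tangent space of the foliation at `m` is K =
ker dφ, of dimension r (`IsMomentumMap.tangent_eq`), and the NCI condition says that K is spanned by
the Hamiltonian vector fields of first integrals kᵢ.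

If X_f is tangent to K, then df(X_{kᵢ}) = {f, kᵢ} = -dkᵢ(X_f) = 0, so df kills K and f is constant
along the leaves, locally or on saturated sets. If dg and dh kill K near a point, so does d{g, h}:
the Jacobi identity with kᵢ leaves only {kᵢ, {g, h}} = 0. Hence brackets of functions pulled back
from B are again constant on fibers. Pushing Π forward at an arbitrary point of each fiber therefore
gives a bracket on B independent of the choice; its smoothness and Jacobi identity can be checked
after pulling back to M. Uniqueness holds because every covector is the differential of a local
function.

The rank formula is linear algebra. With S = Π♯ and A = dφ, the new bivector is A S Aᵀ, and Aᵀ has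
image the annihilator K° of K. As K is spanned by S(dkᵢ) with dkᵢ in K°, skewness gives ker S ⊆ K°
and K ⊆ S(K°); counting dimensions, r is lost in restricting S to K° and r again in dividing by K.
-/

namespace NCI

/-! ### Submersions: local sections and descent of functions -/

section Submersion

variable {n q : ℕ} {M B : Type*} [TopologicalSpace M] [ChartedSpace (EuclideanSpace ℝ (Fin n)) M]
  [TopologicalSpace B] [ChartedSpace (EuclideanSpace ℝ (Fin q)) B]

/-- A submersion is a linear projection in suitable smooth coordinates. -/
theorem exists_adapted_charts {φ : M → B}
    (hφ : Manifold.IsSubmersion (𝓡 n) (𝓡 q) ∞ φ) (m : M) :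
    ∃ (G : Type) (_ : NormedAddCommGroup G) (_ : NormedSpace ℝ G)
      (c : OpenPartialHomeomorph M (EuclideanSpace ℝ (Fin q) × G))
      (d : OpenPartialHomeomorph B (EuclideanSpace ℝ (Fin q))),
      m ∈ c.source ∧ MapsTo φ c.source d.source ∧ (∀ x ∈ c.source, d (φ x) = (c x).1) ∧
      ContMDiffOn 𝓘(ℝ, EuclideanSpace ℝ (Fin q) × G) (𝓡 n) ∞ c.symm c.target ∧
      ContMDiffOn (𝓡 q) (𝓡 q) ∞ d d.source := by
  have h := hφ.isSubmersionAt m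
  refine ⟨h.complement, inferInstance, inferInstance,
    h.domChart.transHomeomorph h.equiv.toHomeomorph, h.codChart, h.mem_domChart_source,
    h.source_subset_preimage_source, fun x hx => ?_, ?_,
    contMDiffOn_of_mem_maximalAtlas h.codChart_mem_maximalAtlas⟩
  · have hx' : x ∈ h.domChart.source := hx
    have := h.writtenInCharts ((h.domChart.extend (𝓡 n)).map_source (by simpa using hx'))
    simpa [h.domChart.left_inv hx'] using this
  · have h1 := contMDiffOn_symm_of_mem_maximalAtlas (I := 𝓡 n) h.domChart_mem_maximalAtlas
    have h2 : ContMDiff 𝓘(ℝ, EuclideanSpace ℝ (Fin q) × h.complement) (𝓡 n) ∞ h.equiv.symm :=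
      h.equiv.symm.contDiff.contMDiff
    exact h1.comp h2.contMDiffOn fun y hy => hy

/-- In adapted charts, freezing the fiber coordinate at its value at `m` gives a section.
Surjectivity of dφ, openness of φ and descent of smoothness all follow from it. -/
theorem exists_local_section {φ : M → B}
    (hφ : Manifold.IsSubmersion (𝓡 n) (𝓡 q) ∞ φ) (m : M) :
    ∃ (V : Set B) (s : B → M), IsOpen V ∧ φ m ∈ V ∧ ContMDiffOn (𝓡 q) (𝓡 n) ∞ s V ∧
      s (φ m) = m ∧ ∀ b ∈ V, φ (s b) = b := by
  obtain ⟨G, _, _, c, d, hm, hcd, hpr, hc, hd⟩ := exists_adapted_charts hφ m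
  have hk : ContMDiffOn (𝓡 q) 𝓘(ℝ, EuclideanSpace ℝ (Fin q) × G) ∞
      (fun b => (d b, (c m).2)) d.source := hd.prodMk_space contMDiffOn_const
  refine ⟨d.source ∩ (fun b => (d b, (c m).2)) ⁻¹' c.target, fun b => c.symm (d b, (c m).2),
    hk.continuousOn.isOpen_inter_preimage d.open_source c.open_target, ⟨hcd hm, ?_⟩,
    hc.comp (hk.mono inter_subset_left) fun b hb => hb.2, ?_, fun b hb => ?_⟩
  · simpa [hpr m hm] using c.map_source hm
  · simp [hpr m hm, c.left_inv hm]
  · have h1 : c.symm (d b, (c m).2) ∈ c.source := c.map_target hb.2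
    refine d.injOn (hcd h1) hb.1 ?_
    rw [hpr _ h1, c.right_inv hb.2]

theorem surjective_mfderiv_of_isSubmersion {φ : M → B}
    (hφ : Manifold.IsSubmersion (𝓡 n) (𝓡 q) ∞ φ) (m : M) :
    Function.Surjective (mfderiv (𝓡 n) (𝓡 q) φ m) := by
  obtain ⟨V, s, hV, hmV, hs, hsm, hφs⟩ := exists_local_section hφ m
  have h1 : MDifferentiableAt (𝓡 q) (𝓡 n) s (φ m) :=
    (hs.contMDiffAt (hV.mem_nhds hmV)).mdifferentiableAt (by simp)
  have h2 : MDifferentiableAt (𝓡 n) (𝓡 q) φ (s (φ m)) :=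
    hφ.contMDiff.mdifferentiableAt (by simp)
  have h3 : φ ∘ s =ᶠ[𝓝 (φ m)] id := Filter.eventuallyEq_of_mem (hV.mem_nhds hmV) hφs
  have h4 := (h2.hasMFDerivAt.comp (φ m) h1.hasMFDerivAt).congr_of_eventuallyEq h3.symm
  have h5 := hasMFDerivAt_unique h4 (hasMFDerivAt_id (φ m))
  have key : Function.Surjective (mfderiv (𝓡 n) (𝓡 q) φ (s (φ m))) :=
    fun v => ⟨mfderiv (𝓡 q) (𝓡 n) s (φ m) v, DFunLike.congr_fun h5 v⟩
  rwa [hsm] at key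

theorem isOpen_image_of_isSubmersion {φ : M → B}
    (hφ : Manifold.IsSubmersion (𝓡 n) (𝓡 q) ∞ φ) {U : Set M} (hU : IsOpen U) :
    IsOpen (φ '' U) := by
  rw [isOpen_iff_mem_nhds]
  rintro _ ⟨m, hm, rfl⟩
  obtain ⟨V, s, hV, hmV, hs, hsm, hφs⟩ := exists_local_section hφ m
  have h1 : s ⁻¹' U ∈ 𝓝 (φ m) :=
    (hs.continuousOn.continuousAt (hV.mem_nhds hmV)).preimage_mem_nhds
      (hU.mem_nhds (by rwa [hsm]))
  filter_upwards [h1, hV.mem_nhds hmV] with b hb hbV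
  exact ⟨s b, hb, hφs b hbV⟩

/-- A function which becomes smooth after composition with a submersion is smooth. -/
theorem contMDiffOn_of_comp_isSubmersion {φ : M → B}
    (hφ : Manifold.IsSubmersion (𝓡 n) (𝓡 q) ∞ φ) {U : Set M} (hU : IsOpen U) {g : B → ℝ}
    (hg : ContMDiffOn (𝓡 n) 𝓘(ℝ, ℝ) ∞ (g ∘ φ) U) :
    ContMDiffOn (𝓡 q) 𝓘(ℝ, ℝ) ∞ g (φ '' U) := by
  rintro _ ⟨m, hm, rfl⟩
  obtain ⟨V, s, hV, hmV, hs, hsm, hφs⟩ := exists_local_section hφ m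
  have h1 : ContMDiffAt (𝓡 n) 𝓘(ℝ, ℝ) ∞ (g ∘ φ) (s (φ m)) := by
    rw [hsm]; exact hg.contMDiffAt (hU.mem_nhds hm)
  have h2 := h1.comp (φ m) (hs.contMDiffAt (hV.mem_nhds hmV))
  refine (h2.congr_of_eventuallyEq ?_).contMDiffWithinAt
  filter_upwards [hV.mem_nhds hmV] with b hb
  simp [hφs b hb]

/-- If `df` vanishes on `ker dφ`, then `f` is constant along convex pieces of fibers of `φ`. -/
theorem eq_of_ker_mfderiv_le {G : Type*} [NormedAddCommGroup G] [NormedSpace ℝ G] {A : Set G}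
    (hA : IsOpen A) (hc : Convex ℝ A) {s : G → M} {φ : M → B} {f : M → ℝ} {b : B}
    (hs : ∀ w ∈ A, MDifferentiableAt 𝓘(ℝ, G) (𝓡 n) s w)
    (hφ : ∀ w ∈ A, MDifferentiableAt (𝓡 n) (𝓡 q) φ (s w)) (hb : ∀ w ∈ A, φ (s w) = b)
    (hf : ∀ w ∈ A, MDifferentiableAt (𝓡 n) 𝓘(ℝ, ℝ) f (s w))
    (hk : ∀ w ∈ A, ∀ v, mfderiv (𝓡 n) (𝓡 q) φ (s w) v = 0 → mvfderiv (𝓡 n) f (s w) v = 0)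
    {w w' : G} (hw : w ∈ A) (hw' : w' ∈ A) : f (s w) = f (s w') := by
  have hd : ∀ z ∈ A, MDifferentiableAt 𝓘(ℝ, G) 𝓘(ℝ, ℝ) (f ∘ s) z := fun z hz =>
    (hf z hz).comp z (hs z hz)
  refine hc.is_const_of_fderivWithin_eq_zero (f := f ∘ s) (𝕜 := ℝ)
    (fun z hz => (hd z hz).differentiableAt.differentiableWithinAt) (fun z hz => ?_) hw hw'
  rw [fderivWithin_of_isOpen hA hz, ← mfderiv_eq_fderiv, mfderiv_comp z (hf z hz) (hs z hz)]
  -- Since `φ ∘ s` is locally constant, the image of ds lies in ker dφ, where df vanishes.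
  have h0 : φ ∘ s =ᶠ[𝓝 z] fun _ => b := Filter.eventuallyEq_of_mem (hA.mem_nhds hz) hb
  have h1 := ((hφ z hz).hasMFDerivAt.comp z (hs z hz).hasMFDerivAt).congr_of_eventuallyEq h0.symm
  have h2 := hasMFDerivAt_unique h1 (hasMFDerivAt_const b z)
  ext v
  exact hk z hz _ (DFunLike.congr_fun h2 v)

/-- A function whose differential vanishes on `ker dφ` is locally constant along the fibers of the
submersion `φ`. -/
theorem exists_nhds_eq_of_ker_mfderiv_le {φ : M → B}
    (hφ : Manifold.IsSubmersion (𝓡 n) (𝓡 q) ∞ φ) {U : Set M} (hU : IsOpen U) {f : M → ℝ}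
    (hf : ContMDiffOn (𝓡 n) 𝓘(ℝ, ℝ) ∞ f U)
    (hk : ∀ x ∈ U, ∀ v, mfderiv (𝓡 n) (𝓡 q) φ x v = 0 → mvfderiv (𝓡 n) f x v = 0)
    {m : M} (hm : m ∈ U) :
    ∃ U' : Set M, IsOpen U' ∧ m ∈ U' ∧ U' ⊆ U ∧ ∀ x ∈ U', ∀ y ∈ U', φ x = φ y → f x = f y := by
  obtain ⟨G, _, _, c, d, hmc, hcd, hpr, hc, hd⟩ := exists_adapted_charts hφ m
  have hO : IsOpen (c.target ∩ c.symm ⁻¹' U) := c.isOpen_inter_preimage_symm hU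
  obtain ⟨ε, hε, hball⟩ := Metric.isOpen_iff.1 hO (c m) ⟨c.map_source hmc, by
    simpa [c.left_inv hmc] using hm⟩
  refine ⟨c.source ∩ c ⁻¹' Metric.ball (c m) ε, c.isOpen_inter_preimage Metric.isOpen_ball,
    ⟨hmc, Metric.mem_ball_self hε⟩, fun x hx => ?_, fun x hx y hy hxy => ?_⟩
  · simpa [c.left_inv hx.1] using (hball hx.2).2
  · have h1 : (c x).1 = (c y).1 := by rw [← hpr x hx.1, ← hpr y hy.1, hxy]
    have hcont : Continuous fun w : G => ((c x).1, w) := by fun_prop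
    -- The fiber of φ through `x`, seen in the chart: a slice of a ball, hence convex.
    set A : Set G := (fun w : G => ((c x).1, w)) ⁻¹' Metric.ball (c m) ε with hAdef
    have hAo : IsOpen A := Metric.isOpen_ball.preimage hcont
    have hAc : Convex ℝ A := by
      intro u hu v hv a b ha hb hab
      have := convex_ball (c m) ε hu hv ha hb hab
      have e : a • ((c x).1, u) + b • ((c x).1, v) = ((c x).1, a • u + b • v) := by
        ext1
        · simp [← add_smul, hab]
        · simp
      rw [e] at this
      exact this
    have hmem : ∀ w ∈ A, ((c x).1, w) ∈ c.target ∧ c.symm ((c x).1, w) ∈ U :=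
      fun w hw => hball hw
    have key := eq_of_ker_mfderiv_le (n := n) (q := q) hAo hAc
      (s := fun w => c.symm ((c x).1, w)) (φ := φ) (f := f) (b := φ x)
      (fun w hw => ?_) (fun w hw => hφ.contMDiff.mdifferentiableAt (by simp)) (fun w hw => ?_)
      (fun w hw => (hf.contMDiffAt (hU.mem_nhds (hmem w hw).2)).mdifferentiableAt (by simp))
      (fun w hw => hk _ (hmem w hw).2)
      (w := (c x).2) (w' := (c y).2) hx.2 (by rw [hAdef, mem_preimage, h1]; exact hy.2)
    · rw [Prod.mk.eta, c.left_inv hx.1, h1, Prod.mk.eta, c.left_inv hy.1] at key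
      exact key
    · have h2 : MDifferentiableAt 𝓘(ℝ, EuclideanSpace ℝ (Fin q) × G) (𝓡 n) c.symm
          ((c x).1, w) :=
        (hc.contMDiffAt (c.open_target.mem_nhds (hmem w hw).1)).mdifferentiableAt (by simp)
      have h3 : MDifferentiableAt 𝓘(ℝ, G) 𝓘(ℝ, EuclideanSpace ℝ (Fin q) × G)
          (fun w : G => ((c x).1, w)) w :=
        (show DifferentiableAt ℝ (fun w : G => ((c x).1, w)) w by fun_prop).mdifferentiableAt
      exact h2.comp w h3
    · have h2 := c.map_target (hmem w hw).1
      refine d.injOn (hcd h2) (hcd hx.1) ?_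
      rw [hpr _ h2, hpr _ hx.1, c.right_inv (hmem w hw).1]

end Submersion

end NCI

/-! ### Tangent spaces of the leaves and functions constant along them -/

namespace NCI

section TangentSpace

variable {n : ℕ} {M : Type*} [TopologicalSpace M] [ChartedSpace (EuclideanSpace ℝ (Fin n)) M]

instance finiteDimensional_tangentSpace (m : M) : FiniteDimensional ℝ (TangentSpace (𝓡 n) m) :=
  inferInstanceAs (FiniteDimensional ℝ (EuclideanSpace ℝ (Fin n)))

theorem finrank_tangentSpace (m : M) : Module.finrank ℝ (TangentSpace (𝓡 n) m) = n :=
  finrank_euclideanSpace_fin (𝕜 := ℝ) (n := n)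

end TangentSpace

namespace Foliation

variable {n r q : ℕ} {M B : Type*} [TopologicalSpace M]
  [ChartedSpace (EuclideanSpace ℝ (Fin n)) M]
  [TopologicalSpace B] [ChartedSpace (EuclideanSpace ℝ (Fin q)) B] (F : Foliation n r q M)
  {e : OpenPartialHomeomorph M (EuclideanSpace ℝ (Fin r) × EuclideanSpace ℝ (Fin q))}

include F in
theorem mdifferentiableAt_chart (he : e ∈ F.charts) {m : M} (hm : m ∈ e.source) :
    MDifferentiableAt (𝓡 n) 𝓘(ℝ, EuclideanSpace ℝ (Fin r) × EuclideanSpace ℝ (Fin q)) e m :=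
  ((F.smooth e he).contMDiffAt (e.open_source.mem_nhds hm)).mdifferentiableAt (by simp)

include F in
theorem mdifferentiable_symm (he : e ∈ F.charts) :
    MDifferentiable 𝓘(ℝ, EuclideanSpace ℝ (Fin r) × EuclideanSpace ℝ (Fin q)) (𝓡 n) e.symm :=
  (F.smooth_symm e he).mdifferentiable (by simp)

/-- The parametrization of the plaque through `m` of a foliated chart. -/
def plaque (e : OpenPartialHomeomorph M (EuclideanSpace ℝ (Fin r) × EuclideanSpace ℝ (Fin q)))
    (m : M) (t : EuclideanSpace ℝ (Fin r)) : M := e.symm (t, (e m).2)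

theorem plaque_self {m : M} (hm : m ∈ e.source) : plaque e m (e m).1 = m := e.left_inv hm

include F in
theorem plaque_mem (he : e ∈ F.charts) (m : M) (t : EuclideanSpace ℝ (Fin r)) :
    plaque e m t ∈ e.source := e.map_target (by simp [F.target_eq e he])

include F in
theorem chart_plaque (he : e ∈ F.charts) (m : M) (t : EuclideanSpace ℝ (Fin r)) :
    e (plaque e m t) = (t, (e m).2) := e.right_inv (by simp [F.target_eq e he])

theorem samePlaque_plaque (he : e ∈ F.charts) {m : M} (hm : m ∈ e.source)
    (t : EuclideanSpace ℝ (Fin r)) : F.SamePlaque (plaque e m t) m :=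
  ⟨e, he, F.plaque_mem he m t, hm, by rw [F.chart_plaque he]⟩

include F in
theorem mdifferentiable_plaque (he : e ∈ F.charts) (m : M) :
    MDifferentiable 𝓘(ℝ, EuclideanSpace ℝ (Fin r)) (𝓡 n) (plaque e m) := fun t =>
  (F.mdifferentiable_symm he _).comp t
    (show DifferentiableAt ℝ (fun t => (t, (e m).2)) t by fun_prop).mdifferentiableAt

include F in
theorem mfderiv_symm_mfderiv (he : e ∈ F.charts) {m : M} (hm : m ∈ e.source)
    (v : TangentSpace (𝓡 n) m) :
    mfderiv 𝓘(ℝ, EuclideanSpace ℝ (Fin r) × EuclideanSpace ℝ (Fin q)) (𝓡 n) e.symm (e m)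
      (mfderiv (𝓡 n) 𝓘(ℝ, EuclideanSpace ℝ (Fin r) × EuclideanSpace ℝ (Fin q)) e m v) = v := by
  have h := ((F.mdifferentiable_symm he (e m)).hasMFDerivAt.comp m
    (F.mdifferentiableAt_chart he hm).hasMFDerivAt).congr_of_eventuallyEq (f₁ := id)
    (Filter.eventuallyEq_of_mem (e.open_source.mem_nhds hm) fun x hx => (e.left_inv hx).symm)
  exact DFunLike.congr_fun (hasMFDerivAt_unique h (hasMFDerivAt_id m)) v

include F in
theorem mfderiv_mfderiv_symm (he : e ∈ F.charts) {m : M} (hm : m ∈ e.source)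
    (v : EuclideanSpace ℝ (Fin r) × EuclideanSpace ℝ (Fin q)) :
    mfderiv (𝓡 n) 𝓘(ℝ, EuclideanSpace ℝ (Fin r) × EuclideanSpace ℝ (Fin q)) e m
      (mfderiv 𝓘(ℝ, EuclideanSpace ℝ (Fin r) × EuclideanSpace ℝ (Fin q)) (𝓡 n) e.symm (e m) v)
      = v := by
  have h1 : HasMFDerivAt (𝓡 n) 𝓘(ℝ, EuclideanSpace ℝ (Fin r) × EuclideanSpace ℝ (Fin q)) e
      (e.symm (e m))
      (mfderiv (𝓡 n) 𝓘(ℝ, EuclideanSpace ℝ (Fin r) × EuclideanSpace ℝ (Fin q)) e m) := by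
    -- The base point `e.symm (e m)` is only propositionally equal to `m`, so the derivative is
    -- transported along a generic `m'`.
    have h0 : ∀ m', m' = m → HasMFDerivAt (𝓡 n)
        𝓘(ℝ, EuclideanSpace ℝ (Fin r) × EuclideanSpace ℝ (Fin q)) e m'
        (mfderiv (𝓡 n) 𝓘(ℝ, EuclideanSpace ℝ (Fin r) × EuclideanSpace ℝ (Fin q)) e m) := by
      rintro _ rfl
      exact (F.mdifferentiableAt_chart he hm).hasMFDerivAt
    exact h0 _ (e.left_inv hm)
  have h := (h1.comp (e m)
    (F.mdifferentiable_symm he (e m)).hasMFDerivAt).congr_of_eventuallyEq (f₁ := id)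
    (Filter.Eventually.of_forall fun x => (e.right_inv (by simp [F.target_eq e he])).symm)
  exact DFunLike.congr_fun (hasMFDerivAt_unique h (hasMFDerivAt_id (e m))) v

include F in
theorem mvfderiv_transverse (he : e ∈ F.charts) {m : M} (hm : m ∈ e.source)
    (v : TangentSpace (𝓡 n) m) :
    mvfderiv (𝓡 n) (fun x => (e x).2) m v =
      Prod.snd (α := EuclideanSpace ℝ (Fin r)) (β := EuclideanSpace ℝ (Fin q))
        (mfderiv (𝓡 n) 𝓘(ℝ, EuclideanSpace ℝ (Fin r) × EuclideanSpace ℝ (Fin q)) e m v) := by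
  have h1 : HasMFDerivAt 𝓘(ℝ, EuclideanSpace ℝ (Fin r) × EuclideanSpace ℝ (Fin q))
      𝓘(ℝ, EuclideanSpace ℝ (Fin q)) Prod.snd (e m)
      (ContinuousLinearMap.snd ℝ (EuclideanSpace ℝ (Fin r)) (EuclideanSpace ℝ (Fin q))) :=
    (hasFDerivAt_snd (p := e m)).hasMFDerivAt
  have h := h1.comp m (F.mdifferentiableAt_chart he hm).hasMFDerivAt
  have h2 := hasMFDerivAt_unique (h.mdifferentiableAt.hasMFDerivAt) h
  exact DFunLike.congr_fun h2 v

include F in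
/-- Vectors killed by the transverse coordinates are tangent to the plaque. -/
theorem mfderiv_plaque (he : e ∈ F.charts) {m : M} (hm : m ∈ e.source)
    {v : TangentSpace (𝓡 n) m} (hv : mvfderiv (𝓡 n) (fun x => (e x).2) m v = 0) :
    mfderiv 𝓘(ℝ, EuclideanSpace ℝ (Fin r)) (𝓡 n) (plaque e m) (e m).1
      (Prod.fst (α := EuclideanSpace ℝ (Fin r)) (β := EuclideanSpace ℝ (Fin q))
        (mfderiv (𝓡 n) 𝓘(ℝ, EuclideanSpace ℝ (Fin r) × EuclideanSpace ℝ (Fin q)) e m v)) = v := by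
  rw [F.mvfderiv_transverse he hm] at hv
  have h1 : HasMFDerivAt 𝓘(ℝ, EuclideanSpace ℝ (Fin r))
      𝓘(ℝ, EuclideanSpace ℝ (Fin r) × EuclideanSpace ℝ (Fin q))
      (fun t => (t, (e m).2)) (e m).1
      (ContinuousLinearMap.inl ℝ (EuclideanSpace ℝ (Fin r)) (EuclideanSpace ℝ (Fin q))) :=
    (hasFDerivAt_prodMk_left (𝕜 := ℝ) (e m).1 (e m).2).hasMFDerivAt
  have h2 := (F.mdifferentiable_symm he (e m)).hasMFDerivAt.comp (e m).1 h1
  have h3 := hasMFDerivAt_unique (h2.mdifferentiableAt.hasMFDerivAt) h2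
  refine (DFunLike.congr_fun h3 _).trans ?_
  refine Eq.trans ?_ (F.mfderiv_symm_mfderiv he hm v)
  refine congrArg (mfderiv 𝓘(ℝ, EuclideanSpace ℝ (Fin r) × EuclideanSpace ℝ (Fin q)) (𝓡 n)
    e.symm (e m)) ?_
  exact Prod.ext rfl hv.symm

include F in
/-- The differential of a function that is constant along a plaque kills the vectors tangent to
that plaque. -/
theorem mfderiv_eq_zero_of_plaque {E' H' N : Type*} [NormedAddCommGroup E'] [NormedSpace ℝ E']
    [TopologicalSpace H'] {I' : ModelWithCorners ℝ E' H'} [TopologicalSpace N] [ChartedSpace H' N]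
    (he : e ∈ F.charts) {m : M} (hm : m ∈ e.source) {h : M → N}
    (hd : MDifferentiableAt (𝓡 n) I' h m)
    (hc : ∀ᶠ t in 𝓝 (e m).1, h (plaque e m t) = h m)
    {v : TangentSpace (𝓡 n) m} (hv : mvfderiv (𝓡 n) (fun x => (e x).2) m v = 0) :
    mfderiv (𝓡 n) I' h m v = 0 := by
  have hd' : MDifferentiableAt (𝓡 n) I' h (plaque e m (e m).1) := by rwa [plaque_self hm]
  have h1 := (hd'.hasMFDerivAt.comp (e m).1
    (F.mdifferentiable_plaque he m _).hasMFDerivAt).congr_of_eventuallyEq (f₁ := fun _ => h m)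
      (hc.mono fun t ht => ht.symm)
  have h2 := DFunLike.congr_fun (hasMFDerivAt_unique h1 (hasMFDerivAt_const (h m) (e m).1))
    (Prod.fst (α := EuclideanSpace ℝ (Fin r)) (β := EuclideanSpace ℝ (Fin q))
      (mfderiv (𝓡 n) 𝓘(ℝ, EuclideanSpace ℝ (Fin r) × EuclideanSpace ℝ (Fin q)) e m v))
  have h3 := F.mfderiv_plaque he hm hv
  have h4 : mfderiv (𝓡 n) I' h (plaque e m (e m).1)
      (mfderiv 𝓘(ℝ, EuclideanSpace ℝ (Fin r)) (𝓡 n) (plaque e m) (e m).1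
      (Prod.fst (α := EuclideanSpace ℝ (Fin r)) (β := EuclideanSpace ℝ (Fin q))
        (mfderiv (𝓡 n) 𝓘(ℝ, EuclideanSpace ℝ (Fin r) × EuclideanSpace ℝ (Fin q)) e m v))) = 0 := h2
  rw [h3, plaque_self hm] at h4
  exact h4

include F in
-- The differential of a foliated chart at `m` is a linear isomorphism; the point is needed, since
-- an empty manifold imposes no relation.
theorem dim_eq (m : M) : n = r + q := by
  obtain ⟨e, he, hm⟩ := F.cover m
  let D : TangentSpace (𝓡 n) m →ₗ[ℝ] EuclideanSpace ℝ (Fin r) × EuclideanSpace ℝ (Fin q) :=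
    (mfderiv (𝓡 n) 𝓘(ℝ, EuclideanSpace ℝ (Fin r) × EuclideanSpace ℝ (Fin q)) e m).toLinearMap
  have hD : Function.Bijective D :=
    ⟨Function.LeftInverse.injective (g := fun v => mfderiv
      𝓘(ℝ, EuclideanSpace ℝ (Fin r) × EuclideanSpace ℝ (Fin q)) (𝓡 n) e.symm (e m) v)
      (F.mfderiv_symm_mfderiv he hm), fun v => ⟨_, F.mfderiv_mfderiv_symm he hm v⟩⟩
  have := (LinearEquiv.ofBijective D hD).finrank_eq
  rw [finrank_tangentSpace] at this
  simpa using this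

variable {F}

theorem IsMomentumMap.eq_of_samePlaque {φ : M → B} (hφ : F.IsMomentumMap φ) {x y : M}
    (h : F.SamePlaque x y) : φ x = φ y := (hφ.fibers x y).2 (Relation.EqvGen.rel _ _ h)

/-- The tangent spaces of the leaves are the kernels of the differential of the momentum map. -/
theorem IsMomentumMap.ker_transverse {φ : M → B} (hφ : F.IsMomentumMap φ) (he : e ∈ F.charts)
    {m : M} (hm : m ∈ e.source) :
    LinearMap.ker (mvfderiv (𝓡 n) (fun x => (e x).2) m).toLinearMap =
      LinearMap.ker (mfderiv (𝓡 n) (𝓡 q) φ m).toLinearMap := by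
  -- φ is constant on plaques, which gives one inclusion; both differentials are onto a
  -- q-dimensional space, so the kernels have equal dimension.
  apply Submodule.eq_of_le_of_finrank_eq
  · intro v hv
    exact F.mfderiv_eq_zero_of_plaque he hm
      (hφ.isSubmersion.contMDiff.mdifferentiableAt (by simp))
      (Filter.Eventually.of_forall fun t => hφ.eq_of_samePlaque (F.samePlaque_plaque he hm t)) hv
  · have h1 := LinearMap.finrank_range_add_finrank_ker
      (mvfderiv (𝓡 n) (fun x => (e x).2) m).toLinearMap
    have h2 := LinearMap.finrank_range_add_finrank_ker
      (mfderiv (𝓡 n) (𝓡 q) φ m).toLinearMap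
    have s1 : LinearMap.range (mvfderiv (𝓡 n) (fun x => (e x).2) m).toLinearMap = ⊤ := by
      rw [LinearMap.range_eq_top]
      intro w
      refine ⟨mfderiv 𝓘(ℝ, EuclideanSpace ℝ (Fin r) × EuclideanSpace ℝ (Fin q)) (𝓡 n) e.symm (e m)
        ((0, w) : EuclideanSpace ℝ (Fin r) × EuclideanSpace ℝ (Fin q)), ?_⟩
      refine (F.mvfderiv_transverse he hm _).trans ?_
      rw [F.mfderiv_mfderiv_symm he hm]
    have s2 : LinearMap.range (mfderiv (𝓡 n) (𝓡 q) φ m).toLinearMap = ⊤ :=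
      LinearMap.range_eq_top.2 (surjective_mfderiv_of_isSubmersion hφ.isSubmersion m)
    rw [s1, finrank_top] at h1
    rw [s2, finrank_top, finrank_tangentSpace] at h2
    simp only [finrank_euclideanSpace_fin] at h1
    omega

theorem IsMomentumMap.tangent_eq {φ : M → B} (hφ : F.IsMomentumMap φ) (m : M) :
    F.tangent m = LinearMap.ker (mfderiv (𝓡 n) (𝓡 q) φ m).toLinearMap := by
  obtain ⟨e, he, hm⟩ := F.cover m
  refine le_antisymm ?_ (le_iInf₂ fun e' he' => le_iInf fun hm' => (hφ.ker_transverse he' hm').ge)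
  rw [← hφ.ker_transverse he hm]
  exact (iInf₂_le e he).trans (iInf_le _ hm)

theorem IsMomentumMap.mem_tangent {φ : M → B} (hφ : F.IsMomentumMap φ) {m : M}
    {v : TangentSpace (𝓡 n) m} : v ∈ F.tangent m ↔ mfderiv (𝓡 n) (𝓡 q) φ m v = 0 := by
  rw [hφ.tangent_eq]; rfl

/-- This is the only form in which first integrals are used later; it needs constancy along the
plaque merely near `m`. -/
theorem mvfderiv_eq_zero_of_isFirstIntegralOn {f : M → ℝ} {U : Set M} (hU : IsOpen U)
    (hf : F.IsFirstIntegralOn f U) {m : M} (hm : m ∈ U) {v : TangentSpace (𝓡 n) m}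
    (hv : v ∈ F.tangent m) : mvfderiv (𝓡 n) f m v = 0 := by
  obtain ⟨e, he, hme⟩ := F.cover m
  obtain ⟨W, hW, hWc⟩ := hf.2 e he m ⟨hm, hme⟩
  have hv' : mvfderiv (𝓡 n) (fun x => (e x).2) m v = 0 := by
    have h1 : F.tangent m ≤ LinearMap.ker (mvfderiv (𝓡 n) (fun x => (e x).2) m).toLinearMap :=
      (iInf₂_le e he).trans (iInf_le _ hme)
    exact h1 hv
  refine F.mfderiv_eq_zero_of_plaque he hme
    ((hf.1.contMDiffAt (hU.mem_nhds hm)).mdifferentiableAt (by simp)) ?_ hv'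
  have h2 : Filter.Tendsto (plaque e m) (𝓝 (e m).1) (𝓝 m) := by
    have := (F.mdifferentiable_plaque he m (e m).1).continuousAt.tendsto
    rwa [plaque_self hme] at this
  filter_upwards [h2 hW] with t ht
  exact hWc _ ht _ (mem_of_mem_nhds hW) (by rw [F.chart_plaque he])

/-- A function on a saturated open set whose differential kills the tangent spaces of the leaves
is constant on the leaves. -/
theorem IsMomentumMap.eq_of_saturated {φ : M → B} (hφ : F.IsMomentumMap φ) {U : Set M}
    (hU : IsOpen U) (hsat : φ ⁻¹' (φ '' U) = U) {f : M → ℝ}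
    (hf : ContMDiffOn (𝓡 n) 𝓘(ℝ, ℝ) ∞ f U)
    (hk : ∀ x ∈ U, ∀ v ∈ F.tangent x, mvfderiv (𝓡 n) f x v = 0) {x y : M} (hx : x ∈ U)
    (hxy : φ x = φ y) : f x = f y := by
  have hmem : ∀ {a b : M}, φ a = φ b → a ∈ U → b ∈ U := fun {a b} hab ha => by
    rw [← hsat]; exact ⟨a, ha, hab⟩
  -- A plaque lies in one fiber, so saturation keeps it inside `U`; it is parametrized by the whole
  -- convex space ℝʳ, as foliated charts are onto.
  have hpl : ∀ a b, a ∈ U → F.SamePlaque a b → f a = f b := by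
    rintro a b ha ⟨e, he, hae, hbe, hab⟩
    have hc : ∀ t, φ (plaque e a t) = φ a := fun t =>
      hφ.eq_of_samePlaque (F.samePlaque_plaque he hae t)
    have hp : ∀ t, plaque e a t ∈ U := fun t => hmem (hc t).symm ha
    have key := eq_of_ker_mfderiv_le (n := n) (q := q) isOpen_univ convex_univ
      (s := plaque e a) (φ := φ) (f := f) (b := φ a)
      (fun t _ => F.mdifferentiable_plaque he a t)
      (fun t _ => hφ.isSubmersion.contMDiff.mdifferentiableAt (by simp)) (fun t _ => hc t)
      (fun t _ => (hf.contMDiffAt (hU.mem_nhds (hp t))).mdifferentiableAt (by simp))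
      (fun t _ v hv => hk _ (hp t) v (hφ.mem_tangent.2 hv))
      (mem_univ (e a).1) (mem_univ (e b).1)
    rw [plaque_self hae] at key
    rw [key, plaque, hab, Prod.mk.eta, e.left_inv hbe]
  -- All points of a chain of plaques have the same image under φ, so the chain never leaves `U`.
  have hgen : ∀ a b, F.SameLeaf a b → a ∈ U → f a = f b := by
    intro a b hab
    induction hab with
    | rel a b h => exact fun ha => hpl a b ha h
    | refl a => exact fun _ => rfl
    | symm a b h ih =>
      exact fun hb => (ih (hmem ((hφ.fibers _ _).2 h).symm hb)).symm
    | trans a b c h _ ih1 ih2 =>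
      exact fun ha => (ih1 ha).trans (ih2 (hmem ((hφ.fibers _ _).2 h) ha))
  exact hgen x y ((hφ.fibers x y).1 hxy) hx

end Foliation

end NCI

/-! ### Push-forward of bivectors: linear algebra and differentials -/

namespace NCI

section LinearAlgebra

theorem finrank_map_add_finrank_ker {V W : Type*} [AddCommGroup V] [Module ℝ V]
    [FiniteDimensional ℝ V] [AddCommGroup W] [Module ℝ W] (f : V →ₗ[ℝ] W) {p : Submodule ℝ V}
    (h : LinearMap.ker f ≤ p) :
    Module.finrank ℝ (p.map f) + Module.finrank ℝ (LinearMap.ker f) = Module.finrank ℝ p := by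
  have h1 := LinearMap.finrank_range_add_finrank_ker (f.domRestrict p)
  rw [LinearMap.range_domRestrict, LinearMap.ker_domRestrict] at h1
  rw [← h1, (Submodule.comapSubtypeEquivOfLe h).finrank_eq]

variable {V W : Type*} [NormedAddCommGroup V] [NormedSpace ℝ V]
  [NormedAddCommGroup W] [NormedSpace ℝ W]

theorem finrank_clm_real [FiniteDimensional ℝ V] :
    Module.finrank ℝ (V →L[ℝ] ℝ) = Module.finrank ℝ V := by
  rw [← (LinearMap.toContinuousLinearMap (𝕜 := ℝ) (E := V) (F' := ℝ)).finrank_eq]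
  exact Subspace.dual_finrank_eq

/-- The push-forward `A ∘ S ∘ Aᵀ` of a bivector `S : V* → V` along a linear map `A : V → W`. -/
def pushSharp (A : V →L[ℝ] W) (S : (V →L[ℝ] ℝ) →ₗ[ℝ] V) : (W →L[ℝ] ℝ) →ₗ[ℝ] W where
  toFun α := A (S (α.comp A))
  map_add' α β := by simp [ContinuousLinearMap.add_comp]
  map_smul' c α := by simp [ContinuousLinearMap.smul_comp]

theorem pushSharp_skew (A : V →L[ℝ] W) {S : (V →L[ℝ] ℝ) →ₗ[ℝ] V}
    (hS : ∀ α β : V →L[ℝ] ℝ, β (S α) = - α (S β)) (α β : W →L[ℝ] ℝ) :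
    β (pushSharp A S α) = - α (pushSharp A S β) :=
  hS (α.comp A) (β.comp A)

/-- If `ker A` is the image under `S` of covectors vanishing on `ker A`, then the rank of the
push-forward of `S` drops by twice the dimension of `ker A`. -/
theorem finrank_range_pushSharp [FiniteDimensional ℝ V] [FiniteDimensional ℝ W] {ι : Type*}
    {A : V →L[ℝ] W} (hA : Function.Surjective A) {S : (V →L[ℝ] ℝ) →ₗ[ℝ] V}
    (hS : ∀ α β : V →L[ℝ] ℝ, β (S α) = - α (S β)) {f : ι → V →L[ℝ] ℝ}
    (hf : ∀ i, ∀ v, A v = 0 → f i v = 0)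
    (hspan : Submodule.span ℝ (range fun i => S (f i)) = LinearMap.ker A.toLinearMap) :
    Module.finrank ℝ (LinearMap.range (pushSharp A S)) +
      2 * Module.finrank ℝ (LinearMap.ker A.toLinearMap) =
      Module.finrank ℝ (LinearMap.range S) := by
  let T : (W →L[ℝ] ℝ) →ₗ[ℝ] (V →L[ℝ] ℝ) :=
    { toFun := fun β => β.comp A
      map_add' := fun α β => ContinuousLinearMap.add_comp _ _ _
      map_smul' := fun c α => ContinuousLinearMap.smul_comp _ _ _ }
  have hT : Function.Injective T := by
    intro α β h
    ext w
    obtain ⟨v, rfl⟩ := hA w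
    exact DFunLike.congr_fun h v
  -- The image of the transpose `T` is the annihilator of ker A: a covector `α` killing ker A is `(α
  -- ∘ s) ∘ A` for any linear right inverse `s` of `A`.
  have hann : ∀ α : V →L[ℝ] ℝ, (∀ v, A v = 0 → α v = 0) → α ∈ LinearMap.range T := by
    intro α hα
    obtain ⟨s, hs⟩ := A.toLinearMap.exists_rightInverse_of_surjective (LinearMap.range_eq_top.2 hA)
    refine ⟨LinearMap.toContinuousLinearMap (α.toLinearMap ∘ₗ s), ?_⟩
    ext v
    have h1 : A (s (A v)) = A v := LinearMap.congr_fun hs (A v)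
    have h2 := hα (s (A v) - v) (by rw [map_sub, h1, sub_self])
    rw [map_sub, sub_eq_zero] at h2
    exact h2
  -- If S α = 0, skewness gives α(S fᵢ) = -fᵢ(S α) = 0, and the S fᵢ span ker A.
  have hkS : LinearMap.ker S ≤ LinearMap.range T := by
    intro α hα
    refine hann α fun v hv => ?_
    have hle : Submodule.span ℝ (range fun i => S (f i)) ≤ LinearMap.ker α.toLinearMap := by
      rw [Submodule.span_le]
      rintro _ ⟨i, rfl⟩
      have : α (S (f i)) = 0 := by rw [hS, LinearMap.mem_ker.1 hα, map_zero, neg_zero]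
      exact this
    rw [hspan] at hle
    exact hle hv
  have hkA : LinearMap.ker A.toLinearMap ≤ (LinearMap.range T).map S := by
    rw [← hspan, Submodule.span_le]
    rintro _ ⟨i, rfl⟩
    exact ⟨f i, hann _ (hf i), rfl⟩
  have hrange : LinearMap.range (pushSharp A S) =
      ((LinearMap.range T).map S).map A.toLinearMap := by
    rw [← LinearMap.range_comp, ← LinearMap.range_comp]; rfl
  -- With K = ker A, the rank is dim S(K°) - dim K = dim K° - dim ker S - dim K, where dim K° = dim
  -- W = dim V - dim K and dim ker S = dim V - rank S.
  have e1 := finrank_map_add_finrank_ker A.toLinearMap hkA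
  have e2 := finrank_map_add_finrank_ker S hkS
  have e3 := LinearMap.finrank_range_of_inj hT
  have e4 := LinearMap.finrank_range_add_finrank_ker S
  have e5 := LinearMap.finrank_range_add_finrank_ker A.toLinearMap
  rw [LinearMap.range_eq_top.2 hA, finrank_top] at e5
  rw [finrank_clm_real] at e3
  rw [finrank_clm_real] at e4
  rw [hrange]
  omega

end LinearAlgebra

section Calculus

variable {n q : ℕ} {M B : Type*} [TopologicalSpace M] [ChartedSpace (EuclideanSpace ℝ (Fin n)) M]
  [TopologicalSpace B] [ChartedSpace (EuclideanSpace ℝ (Fin q)) B]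

theorem mvfderiv_congr {f g : M → ℝ} {m : M} (h : f =ᶠ[𝓝 m] g) :
    mvfderiv (𝓡 n) f m = mvfderiv (𝓡 n) g m := by
  ext v
  exact DFunLike.congr_fun (h.mfderiv_eq (I := 𝓡 n) (I' := 𝓘(ℝ, ℝ))) v

theorem mvfderiv_eq_zero_of_eventuallyEq {f : M → ℝ} {m : M} (h : ∀ᶠ x in 𝓝 m, f x = 0) :
    mvfderiv (𝓡 n) f m = 0 :=
  (mvfderiv_congr h).trans (mvfderiv_const 0)

/-- Every covector is the differential of a locally defined smooth function. -/
theorem exists_mvfderiv_eq [IsManifold (𝓡 n) ∞ M] (m : M) (α : TangentSpace (𝓡 n) m →L[ℝ] ℝ) :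
    ∃ (V : Set M) (g : M → ℝ), IsOpen V ∧ m ∈ V ∧ ContMDiffOn (𝓡 n) 𝓘(ℝ, ℝ) ∞ g V ∧
      mvfderiv (𝓡 n) g m = α := by
  have : IsManifold (𝓡 n) 1 M := IsManifold.of_le (n := ∞) (by simp)
  obtain ⟨D, hD⟩ := isInvertible_mfderiv_extChartAt (I := 𝓡 n) (mem_extChartAt_source m)
  -- The function sought is linear in the chart: `α` transported by the inverse `D.symm` of the
  -- chart's differential.
  let β : EuclideanSpace ℝ (Fin n) →L[ℝ] ℝ := α.comp D.symm.toContinuousLinearMap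
  have hs : ContMDiffOn (𝓡 n) (𝓡 n) ∞ (extChartAt (𝓡 n) m) (chartAt _ m).source :=
    contMDiffOn_extChartAt
  have hβ : ContMDiff (𝓡 n) 𝓘(ℝ, ℝ) ∞ β := β.contDiff.contMDiff
  refine ⟨(chartAt _ m).source, β ∘ extChartAt (𝓡 n) m, (chartAt _ m).open_source,
    mem_chart_source _ m, hβ.comp_contMDiffOn hs, ?_⟩
  have h1 : MDifferentiableAt (𝓡 n) (𝓡 n) (extChartAt (𝓡 n) m) m :=
    mdifferentiableAt_extChartAt (mem_chart_source _ m)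
  have h2 : HasMFDerivAt (𝓡 n) 𝓘(ℝ, ℝ) β (extChartAt (𝓡 n) m m) β :=
    β.hasFDerivAt.hasMFDerivAt
  have h3 := h2.comp m h1.hasMFDerivAt
  have h4 := hasMFDerivAt_unique h3.mdifferentiableAt.hasMFDerivAt h3
  ext v
  refine (DFunLike.congr_fun h4 v).trans ?_
  have h5 : β (D v) = α v := congrArg α (D.symm_apply_apply v)
  refine Eq.trans ?_ h5
  exact congrArg β (DFunLike.congr_fun hD v).symm

/-- The base point `b` is kept apart from `φ m`, because a chosen point `σ b` satisfies `φ (σ b) =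
b` only propositionally; the model spaces avoid casts between tangent spaces. -/
theorem mvfderiv_comp_eq {φ : M → B} {g : B → ℝ} {m : M} {b : B} (hb : φ m = b)
    (hφ : MDifferentiableAt (𝓡 n) (𝓡 q) φ m) (hg : MDifferentiableAt (𝓡 q) 𝓘(ℝ, ℝ) g b) :
    (mvfderiv (𝓡 n) (g ∘ φ) m : EuclideanSpace ℝ (Fin n) →L[ℝ] ℝ) =
      ContinuousLinearMap.comp (mvfderiv (𝓡 q) g b : EuclideanSpace ℝ (Fin q) →L[ℝ] ℝ)
        (mfderiv (𝓡 n) (𝓡 q) φ m) := by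
  subst hb
  exact mvfderiv_comp m hg hφ

theorem bracketOf_congr
    (sharp : ∀ m : M, (TangentSpace (𝓡 n) m →L[ℝ] ℝ) →ₗ[ℝ] TangentSpace (𝓡 n) m)
    {f f' g g' : M → ℝ} {m : M} (hf : f =ᶠ[𝓝 m] f') (hg : g =ᶠ[𝓝 m] g') :
    bracketOf sharp f g m = bracketOf sharp f' g' m := by
  rw [bracketOf, bracketOf, mvfderiv_congr hf, mvfderiv_congr hg]

/-- The push-forward of a field of bivectors along `φ : M → B`, by means of a choice `σ` of a point
in every fiber of `φ`. -/
noncomputable def quotientSharp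
    (sharp : ∀ m : M, (TangentSpace (𝓡 n) m →L[ℝ] ℝ) →ₗ[ℝ] TangentSpace (𝓡 n) m)
    (φ : M → B) (σ : B → M) (b : B) :
    (TangentSpace (𝓡 q) b →L[ℝ] ℝ) →ₗ[ℝ] TangentSpace (𝓡 q) b :=
  pushSharp (V := EuclideanSpace ℝ (Fin n)) (W := EuclideanSpace ℝ (Fin q))
    (mfderiv (𝓡 n) (𝓡 q) φ (σ b)) (sharp (σ b))

theorem bracketOf_quotientSharp
    (sharp : ∀ m : M, (TangentSpace (𝓡 n) m →L[ℝ] ℝ) →ₗ[ℝ] TangentSpace (𝓡 n) m)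
    {φ : M → B} {σ : B → M} {b : B} (hb : φ (σ b) = b) {g h : B → ℝ}
    (hφ : MDifferentiableAt (𝓡 n) (𝓡 q) φ (σ b))
    (hg : MDifferentiableAt (𝓡 q) 𝓘(ℝ, ℝ) g b) (hh : MDifferentiableAt (𝓡 q) 𝓘(ℝ, ℝ) h b) :
    bracketOf (n := q) (quotientSharp sharp φ σ) g h b = bracketOf sharp (g ∘ φ) (h ∘ φ) (σ b) := by
  have e1 := mvfderiv_comp_eq hb hφ hg
  have e2 := mvfderiv_comp_eq hb hφ hh
  refine Eq.trans ?_ (DFunLike.congr_fun e2 _).symm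
  refine congrArg (fun w => (mvfderiv (𝓡 q) h b : EuclideanSpace ℝ (Fin q) →L[ℝ] ℝ)
    ((mfderiv (𝓡 n) (𝓡 q) φ (σ b) : EuclideanSpace ℝ (Fin n) →L[ℝ] EuclideanSpace ℝ (Fin q))
      (sharp (σ b) w))) e1.symm

end Calculus

end NCI

/-! ### The Poisson structure on the leaf space, its Casimirs and its rank -/

namespace NCI

namespace PoissonStructure

variable {n : ℕ} {M : Type*} [TopologicalSpace M] [ChartedSpace (EuclideanSpace ℝ (Fin n)) M]

theorem bracket_skew (P : PoissonStructure n M) (f g : M → ℝ) (m : M) :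
    P.bracket f g m = - P.bracket g f m := P.skew m _ _

theorem bracket_eq_zero_of_eventuallyEq (P : PoissonStructure n M) (f : M → ℝ) {g : M → ℝ} {m : M}
    (hg : ∀ᶠ x in 𝓝 m, g x = 0) : P.bracket f g m = 0 := by
  rw [bracket, bracketOf, mvfderiv_eq_zero_of_eventuallyEq hg]; rfl

end PoissonStructure

section PoissonMap

variable {n q : ℕ} {M B : Type*} [TopologicalSpace M] [ChartedSpace (EuclideanSpace ℝ (Fin n)) M]
  [TopologicalSpace B] [ChartedSpace (EuclideanSpace ℝ (Fin q)) B]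
  {P : PoissonStructure n M} {Q : PoissonStructure q B} {φ : M → B}

/-- A Poisson map pushes the bivector of its source forward to that of its target. -/
theorem IsPoissonMap.sharp_eq [IsManifold (𝓡 q) ∞ B] (h : IsPoissonMap P Q φ) (m : M) :
    Q.sharp (φ m) = pushSharp (V := EuclideanSpace ℝ (Fin n)) (W := EuclideanSpace ℝ (Fin q))
      (mfderiv (𝓡 n) (𝓡 q) φ m) (P.sharp m) := by
  refine LinearMap.ext fun α => ?_
  refine (SeparatingDual.eq_iff_forall_dual_eq (R := ℝ) (V := EuclideanSpace ℝ (Fin q))).2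
    fun β => ?_
  obtain ⟨V₁, g₁, hV₁, hm₁, hg₁, rfl⟩ := exists_mvfderiv_eq (φ m) α
  obtain ⟨V₂, g₂, hV₂, hm₂, hg₂, rfl⟩ := exists_mvfderiv_eq (φ m) β
  have h1 := h.2 (V₁ ∩ V₂) g₁ g₂ (hV₁.inter hV₂) (hg₁.mono inter_subset_left)
    (hg₂.mono inter_subset_right) m ⟨hm₁, hm₂⟩
  have hφ : MDifferentiableAt (𝓡 n) (𝓡 q) φ m := h.1.mdifferentiableAt (by simp)
  -- Only the value of `σ` at `φ m` matters, so a constant `σ` serves.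
  have h2 := bracketOf_quotientSharp (q := q) P.sharp (φ := φ) (σ := fun _ => m) (b := φ m) rfl hφ
    ((hg₁.contMDiffAt (hV₁.mem_nhds hm₁)).mdifferentiableAt (by simp))
    ((hg₂.contMDiffAt (hV₂.mem_nhds hm₂)).mdifferentiableAt (by simp))
  exact h1.symm.trans h2.symm

end PoissonMap

namespace Foliation

variable {n r q : ℕ} {M B : Type*} [TopologicalSpace M]
  [ChartedSpace (EuclideanSpace ℝ (Fin n)) M]
  [TopologicalSpace B] [ChartedSpace (EuclideanSpace ℝ (Fin q)) B] {F : Foliation n r q M}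
  {P : PoissonStructure n M} {φ : M → B}

/-- A function whose Hamiltonian vector field is tangent to the leaves is a first integral,
infinitesimally. -/
theorem IsAbstractNCI.mvfderiv_eq_zero_of_hamVF_mem (hF : F.IsAbstractNCI P) {f : M → ℝ} {m : M}
    (hf : P.hamVF f m ∈ F.tangent m) {v : TangentSpace (𝓡 n) m} (hv : v ∈ F.tangent m) :
    mvfderiv (𝓡 n) f m v = 0 := by
  obtain ⟨U, hU, hm, k, hk, hspan⟩ := hF m
  have hle : Submodule.span ℝ (range fun i => P.hamVF (k i) m) ≤
      LinearMap.ker (mvfderiv (𝓡 n) f m).toLinearMap := by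
    rw [Submodule.span_le]
    rintro _ ⟨i, rfl⟩
    have h1 : mvfderiv (𝓡 n) f m (P.hamVF (k i) m) = 0 := by
      rw [P.mvfderiv_hamVF, P.bracket_skew, ← P.mvfderiv_hamVF,
        mvfderiv_eq_zero_of_isFirstIntegralOn hU (hk i) hm hf, neg_zero]
    exact h1
  rw [hspan m hm] at hle
  exact hle hv

/-- The Poisson bracket of infinitesimal first integrals is an infinitesimal first integral. -/
theorem IsAbstractNCI.mvfderiv_bracket_eq_zero (hF : F.IsAbstractNCI P) {g h : M → ℝ} {U : Set M}
    (hU : IsOpen U) (hg : ContMDiffOn (𝓡 n) 𝓘(ℝ, ℝ) ∞ g U) (hh : ContMDiffOn (𝓡 n) 𝓘(ℝ, ℝ) ∞ h U)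
    (hkg : ∀ x ∈ U, ∀ v ∈ F.tangent x, mvfderiv (𝓡 n) g x v = 0)
    (hkh : ∀ x ∈ U, ∀ v ∈ F.tangent x, mvfderiv (𝓡 n) h x v = 0)
    {m : M} (hmU : m ∈ U) {v : TangentSpace (𝓡 n) m} (hv : v ∈ F.tangent m) :
    mvfderiv (𝓡 n) (P.bracket g h) m v = 0 := by
  obtain ⟨U₀, hU₀, hm, k, hk, hspan⟩ := hF m
  -- These brackets must vanish on a neighborhood and not just at `m`, since the Jacobi identity
  -- differentiates them.
  have hcomm : ∀ (f : M → ℝ), (∀ x ∈ U, ∀ v ∈ F.tangent x, mvfderiv (𝓡 n) f x v = 0) →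
      ∀ i, ∀ᶠ x in 𝓝 m, P.bracket f (k i) x = 0 := fun f hf i => by
    filter_upwards [hU.mem_nhds hmU, hU₀.mem_nhds hm] with x hx hx₀
    rw [← P.mvfderiv_hamVF]
    exact hf x hx _ (by rw [← hspan x hx₀]; exact Submodule.subset_span ⟨i, rfl⟩)
  have hle : Submodule.span ℝ (range fun i => P.hamVF (k i) m) ≤
      LinearMap.ker (mvfderiv (𝓡 n) (P.bracket g h) m).toLinearMap := by
    rw [Submodule.span_le]
    rintro _ ⟨i, rfl⟩
    have h1 : mvfderiv (𝓡 n) (P.bracket g h) m (P.hamVF (k i) m) = 0 := by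
      have hj : P.bracket (k i) (P.bracket g h) m + P.bracket g (P.bracket h (k i)) m +
          P.bracket h (P.bracket (k i) g) m = 0 :=
        P.jacobi (U ∩ U₀) (k i) g h (hU.inter hU₀) ((hk i).1.mono inter_subset_right)
          (hg.mono inter_subset_left) (hh.mono inter_subset_left) m ⟨hmU, hm⟩
      rw [P.bracket_eq_zero_of_eventuallyEq g (hcomm h hkh i),
        P.bracket_eq_zero_of_eventuallyEq h ((hcomm g hkg i).mono fun x hx => by
          rw [P.bracket_skew, hx, neg_zero]), add_zero, add_zero] at hj
      rw [P.mvfderiv_hamVF, P.bracket_skew, hj, neg_zero]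
    exact h1
  rw [hspan m hm] at hle
  exact hle hv

theorem IsMomentumMap.mvfderiv_comp_eq_zero (hφ : F.IsMomentumMap φ) {g : B → ℝ} {m : M}
    (hg : MDifferentiableAt (𝓡 q) 𝓘(ℝ, ℝ) g (φ m)) {v : TangentSpace (𝓡 n) m}
    (hv : v ∈ F.tangent m) : mvfderiv (𝓡 n) (g ∘ φ) m v = 0 := by
  rw [mvfderiv_comp_apply m hg (hφ.isSubmersion.contMDiff.mdifferentiableAt (by simp)),
    hφ.mem_tangent.1 hv]
  exact map_zero _

theorem IsMomentumMap.preimage_image_preimage (hφ : F.IsMomentumMap φ) (V : Set B) :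
    φ ⁻¹' (φ '' (φ ⁻¹' V)) = φ ⁻¹' V := by
  rw [image_preimage_eq V hφ.surjective]

/-- Brackets of basic functions are constant along the leaves. -/
theorem IsMomentumMap.bracket_comp_eq (hF : F.IsAbstractNCI P) (hφ : F.IsMomentumMap φ)
    {V : Set B} (hV : IsOpen V) {g h : B → ℝ} (hg : ContMDiffOn (𝓡 q) 𝓘(ℝ, ℝ) ∞ g V)
    (hh : ContMDiffOn (𝓡 q) 𝓘(ℝ, ℝ) ∞ h V) {x y : M} (hx : φ x ∈ V) (hxy : φ x = φ y) :
    P.bracket (g ∘ φ) (h ∘ φ) x = P.bracket (g ∘ φ) (h ∘ φ) y := by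
  have hU : IsOpen (φ ⁻¹' V) := hV.preimage hφ.isSubmersion.contMDiff.continuous
  have hcomp : ∀ {f : B → ℝ}, ContMDiffOn (𝓡 q) 𝓘(ℝ, ℝ) ∞ f V →
      ContMDiffOn (𝓡 n) 𝓘(ℝ, ℝ) ∞ (f ∘ φ) (φ ⁻¹' V) := fun hf =>
    hf.comp hφ.isSubmersion.contMDiff.contMDiffOn subset_rfl
  have hk : ∀ {f : B → ℝ}, ContMDiffOn (𝓡 q) 𝓘(ℝ, ℝ) ∞ f V →
      ∀ z ∈ φ ⁻¹' V, ∀ v ∈ F.tangent z, mvfderiv (𝓡 n) (f ∘ φ) z v = 0 := fun hf z hz v hv =>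
    hφ.mvfderiv_comp_eq_zero ((hf.contMDiffAt (hV.mem_nhds hz)).mdifferentiableAt (by simp)) hv
  exact hφ.eq_of_saturated hU (hφ.preimage_image_preimage V)
    (P.smooth _ _ _ hU (hcomp hg) (hcomp hh))
    (fun z hz v hv => hF.mvfderiv_bracket_eq_zero hU (hcomp hg) (hcomp hh) (hk hg) (hk hh) hz hv)
    hx hxy

/-- The bracket of the push-forward of `Π` along the momentum map. -/
theorem IsMomentumMap.bracketOf_quotientSharp (hF : F.IsAbstractNCI P) (hφ : F.IsMomentumMap φ)
    {V : Set B} (hV : IsOpen V) {g h : B → ℝ} (hg : ContMDiffOn (𝓡 q) 𝓘(ℝ, ℝ) ∞ g V)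
    (hh : ContMDiffOn (𝓡 q) 𝓘(ℝ, ℝ) ∞ h V) {m : M} (hm : φ m ∈ V) :
    bracketOf (n := q) (quotientSharp P.sharp φ (Function.surjInv hφ.surjective)) g h (φ m) =
      P.bracket (g ∘ φ) (h ∘ φ) m := by
  have hs : φ (Function.surjInv hφ.surjective (φ m)) = φ m := Function.surjInv_eq _ _
  rw [NCI.bracketOf_quotientSharp (q := q) P.sharp hs
    (hφ.isSubmersion.contMDiff.mdifferentiableAt (by simp))
    ((hg.contMDiffAt (hV.mem_nhds hm)).mdifferentiableAt (by simp))
    ((hh.contMDiffAt (hV.mem_nhds hm)).mdifferentiableAt (by simp))]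
  exact hφ.bracket_comp_eq hF hV hg hh (by rwa [hs]) hs

/-- Pulled back by φ, the bracket becomes a smooth bracket on M, and smoothness descends through a
surjective submersion. -/
theorem IsMomentumMap.contMDiffOn_bracketOf (hF : F.IsAbstractNCI P) (hφ : F.IsMomentumMap φ)
    {V : Set B} (hV : IsOpen V) {g h : B → ℝ} (hg : ContMDiffOn (𝓡 q) 𝓘(ℝ, ℝ) ∞ g V)
    (hh : ContMDiffOn (𝓡 q) 𝓘(ℝ, ℝ) ∞ h V) :
    ContMDiffOn (𝓡 q) 𝓘(ℝ, ℝ) ∞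
      (bracketOf (n := q) (quotientSharp P.sharp φ (Function.surjInv hφ.surjective)) g h) V := by
  have hU : IsOpen (φ ⁻¹' V) := hV.preimage hφ.isSubmersion.contMDiff.continuous
  have h1 := contMDiffOn_of_comp_isSubmersion hφ.isSubmersion hU
    (g := bracketOf (n := q) (quotientSharp P.sharp φ (Function.surjInv hφ.surjective)) g h)
    ((P.smooth _ (g ∘ φ) (h ∘ φ) hU
      (hg.comp hφ.isSubmersion.contMDiff.contMDiffOn subset_rfl)
      (hh.comp hφ.isSubmersion.contMDiff.contMDiffOn subset_rfl)).congr
        fun m hm => hφ.bracketOf_quotientSharp hF hV hg hh hm)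
  rwa [image_preimage_eq V hφ.surjective] at h1

/-- This carries the Jacobi identity down from M. The inner brackets agree on a neighborhood, hence
so do their differentials. -/
theorem IsMomentumMap.bracketOf_bracketOf (hF : F.IsAbstractNCI P) (hφ : F.IsMomentumMap φ)
    {V : Set B} (hV : IsOpen V) {f g h : B → ℝ} (hf : ContMDiffOn (𝓡 q) 𝓘(ℝ, ℝ) ∞ f V)
    (hg : ContMDiffOn (𝓡 q) 𝓘(ℝ, ℝ) ∞ g V)
    (hh : ContMDiffOn (𝓡 q) 𝓘(ℝ, ℝ) ∞ h V) {m : M} (hm : φ m ∈ V) :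
    bracketOf (n := q) (quotientSharp P.sharp φ (Function.surjInv hφ.surjective)) f
      (bracketOf (n := q) (quotientSharp P.sharp φ (Function.surjInv hφ.surjective)) g h) (φ m) =
      P.bracket (f ∘ φ) (P.bracket (g ∘ φ) (h ∘ φ)) m := by
  rw [hφ.bracketOf_quotientSharp hF hV hf (hφ.contMDiffOn_bracketOf hF hV hg hh) hm]
  refine bracketOf_congr _ Filter.EventuallyEq.rfl ?_
  filter_upwards [(hV.preimage hφ.isSubmersion.contMDiff.continuous).mem_nhds hm] with x hx
  exact hφ.bracketOf_quotientSharp hF hV hg hh hx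

/-- The Poisson structure on the leaf space. -/
noncomputable def IsMomentumMap.quotientPoisson (hF : F.IsAbstractNCI P)
    (hφ : F.IsMomentumMap φ) : PoissonStructure q B where
  sharp := quotientSharp P.sharp φ (Function.surjInv hφ.surjective)
  skew b := pushSharp_skew (V := EuclideanSpace ℝ (Fin n)) (W := EuclideanSpace ℝ (Fin q)) _
    (P.skew _)
  smooth V g h hV hg hh := hφ.contMDiffOn_bracketOf hF hV hg hh
  jacobi V f g h hV hf hg hh b hb := by
    obtain ⟨m, rfl⟩ := hφ.surjective b
    have hcomp : ∀ {f : B → ℝ}, ContMDiffOn (𝓡 q) 𝓘(ℝ, ℝ) ∞ f V →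
        ContMDiffOn (𝓡 n) 𝓘(ℝ, ℝ) ∞ (f ∘ φ) (φ ⁻¹' V) := fun hf =>
      hf.comp hφ.isSubmersion.contMDiff.contMDiffOn subset_rfl
    rw [hφ.bracketOf_bracketOf hF hV hf hg hh hb, hφ.bracketOf_bracketOf hF hV hg hh hf hb,
      hφ.bracketOf_bracketOf hF hV hh hf hg hb]
    exact P.jacobi _ _ _ _ (hV.preimage hφ.isSubmersion.contMDiff.continuous)
      (hcomp hf) (hcomp hg) (hcomp hh) m hb

theorem IsMomentumMap.isPoissonMap_quotientPoisson (hF : F.IsAbstractNCI P)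
    (hφ : F.IsMomentumMap φ) : IsPoissonMap P (hφ.quotientPoisson hF) φ :=
  ⟨hφ.isSubmersion.contMDiff, fun _ _ _ hV hg hh _ hm =>
    (hφ.bracketOf_quotientSharp hF hV hg hh hm).symm⟩

/-- Over each point of B, both bivectors are the push-forward of Π from the same point of the fiber.
-/
theorem IsMomentumMap.poissonStructure_unique [IsManifold (𝓡 q) ∞ B] (hφ : F.IsMomentumMap φ)
    {Q Q' : PoissonStructure q B} (hQ : IsPoissonMap P Q φ) (hQ' : IsPoissonMap P Q' φ) :
    Q = Q' := by
  refine PoissonStructure.ext (funext fun b => ?_)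
  obtain ⟨m, rfl⟩ := hφ.surjective b
  rw [hQ.sharp_eq, hQ'.sharp_eq]

theorem IsMomentumMap.finrank_ker (hφ : F.IsMomentumMap φ) (m : M) :
    Module.finrank ℝ (LinearMap.ker (mfderiv (𝓡 n) (𝓡 q) φ m).toLinearMap) = r := by
  have h1 := LinearMap.finrank_range_add_finrank_ker (mfderiv (𝓡 n) (𝓡 q) φ m).toLinearMap
  rw [LinearMap.range_eq_top.2 (surjective_mfderiv_of_isSubmersion hφ.isSubmersion m),
    finrank_top, finrank_tangentSpace, finrank_tangentSpace] at h1
  have := F.dim_eq m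
  omega

theorem IsMomentumMap.rank_add [IsManifold (𝓡 q) ∞ B] (hF : F.IsAbstractNCI P)
    (hφ : F.IsMomentumMap φ) {Q : PoissonStructure q B} (hQ : IsPoissonMap P Q φ) (m : M) :
    Q.rank (φ m) + 2 * r = P.rank m := by
  obtain ⟨U, hU, hm, k, hk, hspan⟩ := hF m
  have key := finrank_range_pushSharp (V := EuclideanSpace ℝ (Fin n))
    (W := EuclideanSpace ℝ (Fin q)) (A := mfderiv (𝓡 n) (𝓡 q) φ m)
    (surjective_mfderiv_of_isSubmersion hφ.isSubmersion m) (S := P.sharp m) (P.skew m)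
    -- The sign comes from X_k = -Π♯(dk).
    (f := fun i => - mvfderiv (𝓡 n) (k i) m)
    (fun i v hv => by
      have := mvfderiv_eq_zero_of_isFirstIntegralOn hU (hk i) hm (hφ.mem_tangent.2 hv)
      exact neg_eq_zero.2 this)
    (by
      refine Eq.trans ?_ ((hspan m hm).trans (hφ.tangent_eq m))
      refine congrArg (Submodule.span ℝ) (congrArg range (funext fun i => ?_))
      exact map_neg (P.sharp m) _)
  have h2 := hφ.finrank_ker m
  rw [PoissonStructure.rank, PoissonStructure.rank, hQ.sharp_eq m, ← h2]
  exact key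

/-- At points of `U`, {g, h} ∘ φ = {f, h ∘ φ} = -d(h ∘ φ)(X_f), which vanishes because X_f is
tangent to the fibers. -/
theorem IsMomentumMap.isCasimirOn [IsManifold (𝓡 q) ∞ B]
    (hφ : F.IsMomentumMap φ) {Q : PoissonStructure q B} (hQ : IsPoissonMap P Q φ)
    {U : Set M} (hU : IsOpen U) {f : M → ℝ} (hf : ContMDiffOn (𝓡 n) 𝓘(ℝ, ℝ) ∞ f U)
    (hX : ∀ m ∈ U, P.hamVF f m ∈ F.tangent m) {g : B → ℝ} (hg : EqOn f (g ∘ φ) U) :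
    Q.IsCasimirOn g (φ '' U) := by
  have hgs : ContMDiffOn (𝓡 q) 𝓘(ℝ, ℝ) ∞ g (φ '' U) :=
    contMDiffOn_of_comp_isSubmersion hφ.isSubmersion hU (hf.congr fun x hx => (hg hx).symm)
  refine ⟨hgs, fun W h hW hWU hh x hx => ?_⟩
  obtain ⟨m, hm, rfl⟩ := hWU hx
  rw [← hQ.2 W g h hW (hgs.mono hWU) hh m hx]
  have h1 : P.bracket (g ∘ φ) (h ∘ φ) m = P.bracket f (h ∘ φ) m :=
    bracketOf_congr _ (Filter.eventuallyEq_of_mem (hU.mem_nhds hm) hg.symm) Filter.EventuallyEq.rfl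
  rw [h1, P.bracket_skew, ← P.mvfderiv_hamVF, hφ.mvfderiv_comp_eq_zero
    ((hh.contMDiffAt (hW.mem_nhds hx)).mdifferentiableAt (by simp)) (hX m hm), neg_zero]

end Foliation

theorem exists_eqOn_comp {M B : Type*} {φ : M → B} {f : M → ℝ} {U : Set M}
    (h : ∀ x ∈ U, ∀ y ∈ U, φ x = φ y → f x = f y) : ∃ g : B → ℝ, EqOn f (g ∘ φ) U := by
  classical
  -- The value 0 off φ(U) is arbitrary.
  refine ⟨fun b => if hb : ∃ x ∈ U, φ x = b then f hb.choose else 0, fun x hx => ?_⟩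
  have hb : ∃ y ∈ U, φ y = φ x := ⟨x, hx, rfl⟩
  simp only [Function.comp_apply, dif_pos hb]
  exact h _ hx _ hb.choose_spec.1 hb.choose_spec.2.symm

end NCI

/-- The rank formula is written additively to avoid truncated subtraction in ℕ. -/
theorem mainTheorem2 {n r q : ℕ} {M B : Type*}
    [TopologicalSpace M] [T2Space M] [ChartedSpace (EuclideanSpace ℝ (Fin n)) M]
    [IsManifold (𝓡 n) ∞ M]
    [TopologicalSpace B] [T2Space B] [ChartedSpace (EuclideanSpace ℝ (Fin q)) B]
    [IsManifold (𝓡 q) ∞ B]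
    (P : NCI.PoissonStructure n M) (F : NCI.Foliation n r q M) (hF : F.IsAbstractNCI P)
    (φ : M → B) (hφ : F.IsMomentumMap φ) :
    (∃! Q : NCI.PoissonStructure q B, NCI.IsPoissonMap P Q φ) ∧
    ∀ Q : NCI.PoissonStructure q B, NCI.IsPoissonMap P Q φ →
      (∀ (U : Set M) (f : M → ℝ), IsOpen U → ContMDiffOn (𝓡 n) 𝓘(ℝ, ℝ) ∞ f U →
        (∀ m ∈ U, P.hamVF f m ∈ F.tangent m) →
        (∀ m ∈ U, ∃ U' : Set M, IsOpen U' ∧ m ∈ U' ∧ U' ⊆ U ∧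
          ∃ g : B → ℝ, EqOn f (g ∘ φ) U') ∧
        (φ ⁻¹' (φ '' U) = U → ∃ g : B → ℝ, EqOn f (g ∘ φ) U) ∧
        (∀ (U' : Set M) (g : B → ℝ), IsOpen U' → U' ⊆ U → EqOn f (g ∘ φ) U' →
          IsOpen (φ '' U') ∧ Q.IsCasimirOn g (φ '' U'))) ∧
      (∀ m : M, Q.rank (φ m) + 2 * r = P.rank m) := by
  refine ⟨⟨hφ.quotientPoisson hF, hφ.isPoissonMap_quotientPoisson hF, fun Q hQ =>
    hφ.poissonStructure_unique hQ (hφ.isPoissonMap_quotientPoisson hF)⟩,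
    fun Q hQ => ⟨fun U f hU hf hX => ⟨fun m hm => ?_, fun hsat => ?_, fun U' g hU' hUU' hg =>
      ⟨NCI.isOpen_image_of_isSubmersion hφ.isSubmersion hU',
        hφ.isCasimirOn hQ hU' (hf.mono hUU') (fun m hm => hX m (hUU' hm)) hg⟩⟩,
      hφ.rank_add hF hQ⟩⟩
  · obtain ⟨U', hU', hmU', hUU', h⟩ := NCI.exists_nhds_eq_of_ker_mfderiv_le hφ.isSubmersion hU hf
      (fun x hx v hv => hF.mvfderiv_eq_zero_of_hamVF_mem (hX x hx) (hφ.mem_tangent.2 hv)) hm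
    exact ⟨U', hU', hmU', hUU', NCI.exists_eqOn_comp h⟩
  · exact NCI.exists_eqOn_comp fun x hx y _ hxy => hφ.eq_of_saturated hU hsat hf
      (fun z hz v hv => hF.mvfderiv_eq_zero_of_hamVF_mem (hX z hz) hv) hx hxy
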